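/- Let $\Gamma$ be a torsion-free discrete subgroup of $PSL(2,\mathbb{R})$, let $S=\Gamma\backslash\mathbb{H}$ be the corresponding hyperbolic surface and let $T^1S=\Gamma\backslash PSL(2,\mathbb{R})$ be its unit tangent bundle, with base point projection $\pi:T^1S\to S$, $\pi(\Gamma g)=\Gamma\, g(i)$. The geodesic flow $g_t$ and the horocycle flow $h_s$ on $T^1S$ are given by right multiplication by $$\begin{pmatrix} e^{t/2} & 0\\ 0 & e^{-t/2}\end{pmatrix}\quad\text{and}\quad \begin{pmatrix} 1 & s\\ 0 & 1\end{pmatrix}$$ respectively, and $h_{\mathbb{R}}(u)=\{h_s(u): s\in\mathbb{R}\}$. A closed geodesic $\alpha$ of length $\ell(\alpha)=\ell>0$ in $S$ is the projection $\{\pi(g_t(v)):t\in\mathbb{R}\}$ of a periodic orbit of the geodesic flow, $g_{\ell}(v)=v$. Let $u\in T^1S$ and let $b\ge a>0$. Suppose that there are a sequence $(\alpha_n)$ of closed geodesics in $S$ of lengths $\ell(\alpha_n)\in[a,b]$ and a sequence of times $t_n\to+\infty$ such that $\pi(g_{t_n}(u))\in\alpha_n$ for all $n$. Then there exists $t_0>0$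 such that $$g_{t_0}(u)\in\overline{h_{\mathbb{R}}(u)}.$$ -/

import Mathlib

open scoped MatrixGroups UpperHalfPlane

noncomputable section

namespace HyperbolicSurface

/-- The centre `{1, -1}` of `SL(2, ℝ)` acts trivially on the upper half-plane. -/
theorem center_smul (g : SL(2, ℝ)) (hg : g ∈ Subgroup.center SL(2, ℝ)) (z : ℍ) : g • z = z := by
  obtain ⟨r, hr, hrg⟩ := Matrix.SpecialLinearGroup.mem_center_iff.mp hg
  have hr0 : (r : ℂ) ≠ 0 := by
    rintro h
    have : r = 0 := by exact_mod_cast h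
    subst this
    simp at hr
  have h00 : g 0 0 = r := by rw [← hrg]; simp
  have h01 : g 0 1 = 0 := by rw [← hrg]; simp
  have h10 : g 1 0 = 0 := by rw [← hrg]; simp
  have h11 : g 1 1 = r := by rw [← hrg]; simp
  apply UpperHalfPlane.ext
  rw [UpperHalfPlane.coe_specialLinearGroup_apply, h00, h01, h10, h11]
  simp only [Algebra.algebraMap_self, RingHom.id_apply, Complex.ofReal_zero, zero_mul, zero_add,
    add_zero]
  field_simp

/-- The action of `PSL(2, ℝ)` on the upper half-plane by Möbius transformations. -/
instance pslAction : MulAction PSL(2, ℝ) ℍ :=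
  MulAction.compHom ℍ (QuotientGroup.lift (Subgroup.center SL(2, ℝ))
    (MulAction.toPermHom SL(2, ℝ) ℍ)
    (fun g hg => Equiv.ext fun z => center_smul g hg z))

theorem mk_smul (g : SL(2, ℝ)) (z : ℍ) : (QuotientGroup.mk g : PSL(2, ℝ)) • z = g • z := rfl

/-- `Γ ≤ PSL(2, ℝ)` is discrete and torsion-free, so that `Γ \ ℍ` is a hyperbolic surface. -/
structure IsSurfaceGroup (Γ : Subgroup PSL(2, ℝ)) : Prop where
  discrete : DiscreteTopology Γ
  torsionFree : ∀ γ ∈ Γ, IsOfFinOrder γ → γ = 1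

/-- The hyperbolic surface `S = Γ \ ℍ`. -/
abbrev Surface (Γ : Subgroup PSL(2, ℝ)) : Type := Quotient (MulAction.orbitRel Γ ℍ)

/-- The unit tangent bundle `T¹S = Γ \ PSL(2, ℝ)` of `S = Γ \ ℍ`, with the quotient topology. The
class of `g` stands for the image under `g` of the upward unit vector at `i`. -/
abbrev UnitTangent (Γ : Subgroup PSL(2, ℝ)) : Type := Quotient (MulAction.orbitRel Γ PSL(2, ℝ))

/-- Right multiplication by `x ∈ PSL(2, ℝ)` on `T¹S = Γ \ PSL(2, ℝ)`. -/
def rightMul {Γ : Subgroup PSL(2, ℝ)} (x : PSL(2, ℝ)) : UnitTangent Γ → UnitTangent Γ :=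
  Quotient.map (fun g => g * x) (by
    rintro _ g ⟨γ, rfl⟩
    exact ⟨γ, (mul_assoc (γ : PSL(2, ℝ)) g x).symm⟩)

/-- The diagonal matrix with entries `e^{t/2}` and `e^{-t/2}`. -/
def diagMatrix (t : ℝ) : SL(2, ℝ) :=
  ⟨!![Real.exp (t / 2), 0; 0, Real.exp (-t / 2)], by
    rw [Matrix.det_fin_two_of, ← Real.exp_add]; ring_nf; simp⟩

/-- The upper triangular unipotent matrix with upper right entry `s`. -/
def unipMatrix (s : ℝ) : SL(2, ℝ) :=
  ⟨!![1, s; 0, 1], by simp [Matrix.det_fin_two_of]⟩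

/-- The geodesic flow `g_t` on `T¹S`. -/
def geodesicFlow {Γ : Subgroup PSL(2, ℝ)} (t : ℝ) : UnitTangent Γ → UnitTangent Γ :=
  rightMul (QuotientGroup.mk (diagMatrix t))

/-- The horocycle flow `h_s` on `T¹S`. -/
def horocycleFlow {Γ : Subgroup PSL(2, ℝ)} (s : ℝ) : UnitTangent Γ → UnitTangent Γ :=
  rightMul (QuotientGroup.mk (unipMatrix s))

/-- The orbit `h_ℝ(u)` of `u` under the horocycle flow. -/
def horocycleOrbit {Γ : Subgroup PSL(2, ℝ)} (u : UnitTangent Γ) : Set (UnitTangent Γ) :=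
  Set.range fun s : ℝ => horocycleFlow s u

/-- The projection `π : T¹S → S` to the base point, induced by `g ↦ g • i`. -/
def basePoint {Γ : Subgroup PSL(2, ℝ)} : UnitTangent Γ → Surface Γ :=
  Quotient.map (fun g : PSL(2, ℝ) => g • UpperHalfPlane.I) (by
    rintro _ g ⟨γ, rfl⟩
    exact ⟨γ, (mul_smul (γ : PSL(2, ℝ)) g UpperHalfPlane.I).symm⟩)

/-- A closed geodesic of `S = Γ \ ℍ`: the unit speed geodesic with initial vector `initial`
followed for the time `length > 0`, at which it returns to its initial vector. The same closed
curve run through several times is allowed, with the length counted accordingly. -/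
structure ClosedGeodesic (Γ : Subgroup PSL(2, ℝ)) where
  initial : UnitTangent Γ
  length : ℝ
  length_pos : 0 < length
  closes : geodesicFlow length initial = initial

/-- The set of points of `S` on a closed geodesic. -/
def ClosedGeodesic.support {Γ : Subgroup PSL(2, ℝ)} (α : ClosedGeodesic Γ) : Set (Surface Γ) :=
  Set.range fun t : ℝ => basePoint (geodesicFlow t α.initial)

end HyperbolicSurface

end

open scoped MatrixGroups UpperHalfPlane

noncomputable section

namespace HyperbolicSurface

/-! Write `u = Γg`, `a_t` for the diagonal and `n_s` for the unipotent matrices. If the geodesic of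
`u` meets a closed geodesic of length `l` at time `t`, then for some rotation `k` about `i` the
vector `Γg a_t k` has period `l`, so `Γg = Γg M` with `M = a_t (k a_l k⁻¹) a_{-t}`. Conjugation by
`a_t` keeps the diagonal of `k a_l k⁻¹` and shrinks its lower left entry by `e^{-t}`; the upper
right entry grows, but a factor `n_s` removes it. Hence `h_s(u) = Γg M n_s` with `M n_s` lower
triangular and nearly diagonal (`exists_conj_mul_unipMatrix_eq_lowerMatrix`).

Its upper left entry is a weighted mean of `e^{l/2}` and `e^{-l/2}`. Replacing `l` by `-l` if
necessary, it is at least `cosh(l/2) > 1`, so the geodesic shift is positive, and it is bounded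
above and away from zero because `l ∈ [a, b]` (`exists_lowerMatrix_mem_horocycleOrbit`). A
convergent subsequence of the shifts gives `t₀`. -/

/-- The point of `T¹S = Γ \ PSL(2, ℝ)` represented by a matrix in `SL(2, ℝ)`. -/
def toUnitTangent (Γ : Subgroup PSL(2, ℝ)) (g : SL(2, ℝ)) : UnitTangent Γ :=
  Quotient.mk _ (QuotientGroup.mk g : PSL(2, ℝ))

variable {Γ : Subgroup PSL(2, ℝ)}

theorem toUnitTangent_surjective : Function.Surjective (toUnitTangent Γ) := by
  intro u
  obtain ⟨g, rfl⟩ := Quotient.exists_rep u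
  obtain ⟨g, rfl⟩ := QuotientGroup.mk_surjective g
  exact ⟨g, rfl⟩

theorem continuous_toUnitTangent : Continuous (toUnitTangent Γ) :=
  continuous_quotient_mk'.comp QuotientGroup.continuous_mk

theorem rightMul_toUnitTangent (g x : SL(2, ℝ)) :
    rightMul (QuotientGroup.mk x) (toUnitTangent Γ g) = toUnitTangent Γ (g * x) := rfl

theorem toUnitTangent_mul_right {g h : SL(2, ℝ)} (x : SL(2, ℝ))
    (hgh : toUnitTangent Γ g = toUnitTangent Γ h) :
    toUnitTangent Γ (g * x) = toUnitTangent Γ (h * x) := by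
  rw [← rightMul_toUnitTangent, hgh, rightMul_toUnitTangent]

theorem geodesicFlow_toUnitTangent (t : ℝ) (g : SL(2, ℝ)) :
    geodesicFlow t (toUnitTangent Γ g) = toUnitTangent Γ (g * diagMatrix t) := rfl

theorem horocycleFlow_toUnitTangent (s : ℝ) (g : SL(2, ℝ)) :
    horocycleFlow s (toUnitTangent Γ g) = toUnitTangent Γ (g * unipMatrix s) := rfl

theorem coe_diagMatrix (t : ℝ) : (diagMatrix t : Matrix (Fin 2) (Fin 2) ℝ) =
    !![Real.exp (t / 2), 0; 0, Real.exp (-t / 2)] := rfl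

theorem diagMatrix_add (s t : ℝ) : diagMatrix (s + t) = diagMatrix s * diagMatrix t := by
  apply Subtype.ext
  rw [Matrix.SpecialLinearGroup.coe_mul]
  simp only [coe_diagMatrix, Matrix.mul_fin_two, ← Real.exp_add, mul_zero, zero_mul, add_zero,
    zero_add]
  ring_nf

theorem diagMatrix_zero : diagMatrix 0 = 1 := by
  ext i j
  fin_cases i <;> fin_cases j <;> simp [diagMatrix]

theorem geodesicFlow_add (s t : ℝ) (u : UnitTangent Γ) :
    geodesicFlow (s + t) u = geodesicFlow t (geodesicFlow s u) := by
  obtain ⟨g, rfl⟩ := toUnitTangent_surjective u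
  simp only [geodesicFlow_toUnitTangent, diagMatrix_add, mul_assoc]

theorem geodesicFlow_zero (u : UnitTangent Γ) : geodesicFlow 0 u = u := by
  obtain ⟨g, rfl⟩ := toUnitTangent_surjective u
  rw [geodesicFlow_toUnitTangent, diagMatrix_zero, mul_one]

theorem geodesicFlow_neg_of_closes {l : ℝ} {v : UnitTangent Γ} (h : geodesicFlow l v = v) :
    geodesicFlow (-l) v = v := by
  conv_lhs => rw [← h]
  rw [← geodesicFlow_add, add_neg_cancel, geodesicFlow_zero]

/-- A point on a closed geodesic is the base point of a periodic vector with the same period. -/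
theorem ClosedGeodesic.exists_periodic (α : ClosedGeodesic Γ) {x : Surface Γ}
    (hx : x ∈ α.support) : ∃ v : UnitTangent Γ, geodesicFlow α.length v = v ∧ basePoint v = x := by
  obtain ⟨s, hs⟩ := hx
  refine ⟨geodesicFlow s α.initial, ?_, hs⟩
  rw [← geodesicFlow_add, add_comm, geodesicFlow_add, α.closes]

/-- The stabilizer of `i` in `SL(2, ℝ)` consists of rotation matrices. -/
theorem rotation_of_smul_I {k : SL(2, ℝ)} (hk : k • UpperHalfPlane.I = UpperHalfPlane.I) :
    k 1 1 = k 0 0 ∧ k 1 0 = -k 0 1 ∧ k 0 0 ^ 2 + k 0 1 ^ 2 = 1 := by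
  have h := congrArg (fun z : ℍ => (z : ℂ)) hk
  have hden : ((k 1 0 : ℝ) : ℂ) * Complex.I + (k 1 1 : ℝ) ≠ 0 := by
    intro h0
    have h1 := congrArg Complex.re h0
    have h2 := congrArg Complex.im h0
    have hd := k.det_coe
    rw [Matrix.det_fin_two] at hd
    simp at h1 h2
    rw [h1, h2] at hd
    simp at hd
  simp only [UpperHalfPlane.coe_specialLinearGroup_apply, UpperHalfPlane.coe_I,
    Algebra.algebraMap_self, RingHom.id_apply] at h
  rw [div_eq_iff hden] at h
  have h1 := congrArg Complex.re h
  have h2 := congrArg Complex.im h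
  simp at h1 h2
  have hd := k.det_coe
  rw [Matrix.det_fin_two] at hd
  refine ⟨h2.symm, by linarith, ?_⟩
  have h3 : k 1 0 = -k 0 1 := by linarith
  rw [← h2, h3] at hd
  linarith

/-- Two vectors with the same base point differ by a rotation. -/
theorem exists_rotation_of_basePoint_eq {x y : SL(2, ℝ)}
    (h : basePoint (toUnitTangent Γ x) = basePoint (toUnitTangent Γ y)) :
    ∃ k : SL(2, ℝ), k • UpperHalfPlane.I = UpperHalfPlane.I ∧
      toUnitTangent Γ x = toUnitTangent Γ (y * k) := by
  obtain ⟨⟨γ, hγ⟩, hxy⟩ := Quotient.exact h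
  obtain ⟨c, rfl⟩ := QuotientGroup.mk_surjective γ
  have hcy : c • y • UpperHalfPlane.I = x • UpperHalfPlane.I := hxy
  -- Both `x` and `c * y` send `i` to the same point, so `(c * y)⁻¹ * x` fixes `i`.
  refine ⟨y⁻¹ * (c⁻¹ * x), ?_, ?_⟩
  · rw [mul_smul, mul_smul, ← hcy, inv_smul_smul, inv_smul_smul]
  · refine Quotient.sound ⟨⟨_, hγ⟩, ?_⟩
    change (QuotientGroup.mk (c * (y * (y⁻¹ * (c⁻¹ * x)))) : PSL(2, ℝ)) = QuotientGroup.mk x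
    congr 1
    group

/-- The lower triangular matrix with diagonal entries `e^{τ/2}`, `e^{-τ/2}` and lower left entry
`w`. -/
def lowerMatrix (τ w : ℝ) : SL(2, ℝ) :=
  ⟨!![Real.exp (τ / 2), 0; w, Real.exp (-τ / 2)], by
    rw [Matrix.det_fin_two_of, ← Real.exp_add]; ring_nf; simp⟩

theorem lowerMatrix_zero (τ : ℝ) : lowerMatrix τ 0 = diagMatrix τ := rfl

theorem continuous_lowerMatrix : Continuous fun x : ℝ × ℝ => lowerMatrix x.1 x.2 := by
  refine Continuous.subtype_mk (continuous_matrix fun i j => ?_) _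
  fin_cases i <;> fin_cases j <;> simp <;> fun_prop

/-- Conjugating a translation by a rotation about `i` and then by `diagMatrix t`, the upper right
entry can be cleared by a unipotent matrix. -/
theorem exists_conj_mul_unipMatrix_eq_lowerMatrix {k : SL(2, ℝ)}
    (hk : k • UpperHalfPlane.I = UpperHalfPlane.I) (t l : ℝ) :
    ∃ s : ℝ, diagMatrix t * k * diagMatrix l * k⁻¹ * diagMatrix (-t) * unipMatrix s =
      lowerMatrix
        (2 * Real.log (k 0 0 ^ 2 * Real.exp (l / 2) + k 0 1 ^ 2 * Real.exp (-l / 2)))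
        (Real.exp (-t) * (k 0 0 * k 0 1 * (Real.exp (-l / 2) - Real.exp (l / 2)))) := by
  obtain ⟨h11, h10, hsq⟩ := rotation_of_smul_I hk
  set c := k 0 0 with hc
  set d := k 0 1 with hd
  set x := Real.exp (l / 2) with hx
  set y := Real.exp (-l / 2) with hy
  have hxy : x * y = 1 := by rw [hx, hy, ← Real.exp_add]; ring_nf; simp
  have hx0 : 0 < x := Real.exp_pos _
  have hy0 : 0 < y := Real.exp_pos _
  set p := c ^ 2 * x + d ^ 2 * y with hp
  have hp0 : 0 < p := by
    rcases eq_or_ne c 0 with h | h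
    · have : d ^ 2 = 1 := by rw [h] at hsq; linarith
      rw [hp, this]; positivity
    · positivity
  set e := Real.exp (t / 2) with he
  set f := Real.exp (-t / 2) with hf
  have hef : e * f = 1 := by rw [he, hf, ← Real.exp_add]; ring_nf; simp
  have hff : Real.exp (-t) = f ^ 2 := by rw [hf, ← Real.exp_nat_mul]; congr 1; push_cast; ring
  have hE : Real.exp (2 * Real.log p / 2) = p := by
    rw [mul_div_cancel_left₀ _ two_ne_zero, Real.exp_log hp0]
  have hE' : Real.exp (-(2 * Real.log p) / 2) = p⁻¹ := by
    rw [show -(2 * Real.log p) / 2 = -Real.log p by ring, Real.exp_neg, Real.exp_log hp0]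
  have hK : (k : Matrix (Fin 2) (Fin 2) ℝ) = !![c, d; -d, c] := by
    ext i j
    fin_cases i <;> fin_cases j <;> simp [hc, hd, h11, h10]
  -- This says that `k a_l k⁻¹` has determinant one.
  have hpr : p * (d ^ 2 * x + c ^ 2 * y) = 1 + (c * d * (y - x)) ^ 2 := by
    rw [hp]
    linear_combination (c ^ 4 + d ^ 4 + 2 * c ^ 2 * d ^ 2) * hxy + (c ^ 2 + d ^ 2 + 1) * hsq
  -- Column operation: minus the upper right entry over the upper left entry `p`.
  refine ⟨-(e ^ 2 * (c * d * (y - x))) / p, ?_⟩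
  apply Subtype.ext
  have hL : ((diagMatrix t * k * diagMatrix l * k⁻¹ * diagMatrix (-t) : SL(2, ℝ)) :
      Matrix (Fin 2) (Fin 2) ℝ) =
      !![p, e ^ 2 * (c * d * (y - x)); f ^ 2 * (c * d * (y - x)), d ^ 2 * x + c ^ 2 * y] := by
    simp only [Matrix.SpecialLinearGroup.coe_mul, Matrix.SpecialLinearGroup.coe_inv, hK,
      Matrix.adjugate_fin_two_of, coe_diagMatrix, neg_neg, ← hx, ← hy, ← he, ← hf,
      Matrix.mul_fin_two]
    ext i j
    fin_cases i <;> fin_cases j <;> simp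
    · linear_combination p * hef
    · ring
    · ring
    · linear_combination (d ^ 2 * x + c ^ 2 * y) * hef
  rw [Matrix.SpecialLinearGroup.coe_mul, hL, hff]
  simp only [unipMatrix, lowerMatrix, hE, hE', Matrix.mul_fin_two]
  ext i j
  fin_cases i <;> fin_cases j <;> simp
  · field_simp
    ring
  · field_simp
    linear_combination hpr - (c * d * (y - x)) ^ 2 * (e * f + 1) * hef

/-- If the geodesic of `u` meets at time `t` a closed geodesic of length `l`, then the horocycle
of `u` contains a lower triangular perturbation of size `O(e^{-t})` of a forward geodesic translate
of `u`. -/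
theorem exists_lowerMatrix_mem_horocycleOrbit (g : SL(2, ℝ)) (t : ℝ) {l : ℝ} (hl : 0 ≤ l)
    {v : UnitTangent Γ} (hv : geodesicFlow l v = v)
    (hbase : basePoint v = basePoint (geodesicFlow t (toUnitTangent Γ g))) :
    ∃ τ q : ℝ, 2 * Real.log (Real.cosh (l / 2)) ≤ τ ∧ τ ≤ l ∧ |q| ≤ Real.exp (l / 2) ∧
      toUnitTangent Γ (g * lowerMatrix τ (Real.exp (-t) * q)) ∈
        horocycleOrbit (toUnitTangent Γ g) := by
  obtain ⟨x, rfl⟩ := toUnitTangent_surjective v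
  obtain ⟨k, hk, hxk⟩ := exists_rotation_of_basePoint_eq hbase
  -- Stated for every period `m`, since both `l` and `-l` are needed.
  have key : ∀ m : ℝ, geodesicFlow m (toUnitTangent Γ x) = toUnitTangent Γ x →
      toUnitTangent Γ (g * lowerMatrix
        (2 * Real.log (k 0 0 ^ 2 * Real.exp (m / 2) + k 0 1 ^ 2 * Real.exp (-m / 2)))
        (Real.exp (-t) * (k 0 0 * k 0 1 * (Real.exp (-m / 2) - Real.exp (m / 2))))) ∈
        horocycleOrbit (toUnitTangent Γ g) := by
    intro m hm
    obtain ⟨s, hs⟩ := exists_conj_mul_unipMatrix_eq_lowerMatrix hk t m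
    refine ⟨s, ?_⟩
    rw [hxk, geodesicFlow_toUnitTangent] at hm
    -- Undoing `a_t k` turns periodicity into `Γg M n_s = Γg n_s`.
    have h := toUnitTangent_mul_right (k⁻¹ * diagMatrix (-t) * unipMatrix s) hm
    have hinv : diagMatrix t * diagMatrix (-t) = 1 := by
      rw [← diagMatrix_add, add_neg_cancel, diagMatrix_zero]
    have h1 : g * diagMatrix t * k * (k⁻¹ * diagMatrix (-t) * unipMatrix s) =
        g * unipMatrix s := by
      calc _ = g * (diagMatrix t * diagMatrix (-t)) * unipMatrix s := by group
        _ = _ := by rw [hinv, mul_one]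
    rw [h1] at h
    change horocycleFlow s (toUnitTangent Γ g) = _
    rw [horocycleFlow_toUnitTangent, ← h, ← hs]
    simp only [mul_assoc]
  obtain ⟨-, -, hsq⟩ := rotation_of_smul_I hk
  set c := k 0 0
  set d := k 0 1
  set X := Real.exp (l / 2) with hX
  set Y := Real.exp (-l / 2) with hY
  have hXY : Y ≤ X := Real.exp_le_exp.mpr (by linarith)
  have hY0 : 0 < Y := Real.exp_pos _
  have hX0 : 0 < X := Real.exp_pos _
  have hcosh : Real.cosh (l / 2) = (X + Y) / 2 := by
    rw [Real.cosh_eq, hX, hY, neg_div]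
  have hlogX : 2 * Real.log X = l := by rw [hX, Real.log_exp]; ring
  have hcd : |c * d| ≤ 1 := by
    rw [abs_le]
    constructor <;> nlinarith [sq_nonneg (c + d), sq_nonneg (c - d)]
  have hq : |c * d * (Y - X)| ≤ X := by
    rw [abs_mul]
    have : |Y - X| ≤ X := by rw [abs_le]; constructor <;> linarith
    nlinarith [abs_nonneg (c * d), abs_nonneg (Y - X)]
  have bounds : ∀ p : ℝ, (X + Y) / 2 ≤ p → p ≤ X →
      2 * Real.log (Real.cosh (l / 2)) ≤ 2 * Real.log p ∧ 2 * Real.log p ≤ l := by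
    intro p hp1 hp2
    have hp0 : 0 < p := by linarith
    rw [hcosh]
    refine ⟨?_, ?_⟩
    · have := Real.log_le_log (by linarith) hp1
      linarith
    · have := Real.log_le_log hp0 hp2
      linarith
  -- As `c² + d² = 1`, the larger square is at least `1/2`. The sign of the period is chosen to give
  -- `e^{l/2}` this weight, so the mean is at least `cosh(l/2)`.
  rcases le_total (d ^ 2) (c ^ 2) with h | h
  · obtain ⟨h1, h2⟩ := bounds (c ^ 2 * X + d ^ 2 * Y) (by nlinarith)
      (by nlinarith [sq_nonneg d])
    exact ⟨_, _, h1, h2, hq, key l hv⟩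
  · obtain ⟨h1, h2⟩ := bounds (c ^ 2 * Y + d ^ 2 * X) (by nlinarith)
      (by nlinarith [sq_nonneg c])
    have h3 := key (-l) (geodesicFlow_neg_of_closes hv)
    rw [neg_neg, ← hX, ← hY] at h3
    refine ⟨_, _, h1, h2, ?_, h3⟩
    rwa [← neg_sub Y X, mul_neg, abs_neg]

end HyperbolicSurface

end

open HyperbolicSurface Filter Topology in
theorem mainTheorem4 (Γ : Subgroup PSL(2, ℝ)) (hΓ : HyperbolicSurface.IsSurfaceGroup Γ)
    (u : HyperbolicSurface.UnitTangent Γ) (a b : ℝ) (ha : 0 < a) (hab : a ≤ b)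
    (α : ℕ → HyperbolicSurface.ClosedGeodesic Γ) (hα : ∀ n, (α n).length ∈ Set.Icc a b)
    (t : ℕ → ℝ) (ht : Filter.Tendsto t Filter.atTop Filter.atTop)
    (hmeet : ∀ n, HyperbolicSurface.basePoint (HyperbolicSurface.geodesicFlow (t n) u)
      ∈ (α n).support) :
    ∃ t₀ : ℝ, 0 < t₀ ∧
      HyperbolicSurface.geodesicFlow t₀ u ∈ closure (HyperbolicSurface.horocycleOrbit u) := by
  obtain ⟨g, rfl⟩ := toUnitTangent_surjective u
  have hstep : ∀ n, ∃ τ q : ℝ, τ ∈ Set.Icc (2 * Real.log (Real.cosh (a / 2))) b ∧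
      |q| ≤ Real.exp (b / 2) ∧ toUnitTangent Γ (g * lowerMatrix τ (Real.exp (-t n) * q)) ∈
        horocycleOrbit (toUnitTangent Γ g) := by
    intro n
    obtain ⟨v, hv, hbase⟩ := (α n).exists_periodic (hmeet n)
    obtain ⟨hl1, hl2⟩ := hα n
    obtain ⟨τ, q, h1, h2, h3, h4⟩ :=
      exists_lowerMatrix_mem_horocycleOrbit g (t n) (α n).length_pos.le hv hbase
    refine ⟨τ, q, ⟨le_trans ?_ h1, h2.trans hl2⟩,
      h3.trans (Real.exp_le_exp.mpr (by linarith)), h4⟩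
    have hc : Real.cosh (a / 2) ≤ Real.cosh ((α n).length / 2) := by
      rw [Real.cosh_le_cosh, abs_of_pos (by linarith), abs_of_pos (by linarith)]
      linarith
    have := Real.log_le_log (Real.cosh_pos _) hc
    linarith
  choose τ q hτ hq hmem using hstep
  obtain ⟨t₀, ht₀, φ, hφ, hlim⟩ := isCompact_Icc.tendsto_subseq hτ
  refine ⟨t₀, lt_of_lt_of_le ?_ ht₀.1, ?_⟩
  · have := Real.log_pos (Real.one_lt_cosh.mpr (by linarith : a / 2 ≠ 0))
    linarith
  -- The factors `q n` need not converge; their uniform bound suffices.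
  have hw : Tendsto (fun n => Real.exp (-t n) * q n) atTop (𝓝 0) := by
    refine (Real.tendsto_exp_neg_atTop_nhds_zero.comp ht).zero_mul_isBoundedUnder_le ?_
    exact isBoundedUnder_of ⟨Real.exp (b / 2), hq⟩
  have hcont : Continuous fun x : ℝ × ℝ => toUnitTangent Γ (g * lowerMatrix x.1 x.2) :=
    continuous_toUnitTangent.comp (continuous_const.mul continuous_lowerMatrix)
  have h := (hcont.tendsto (t₀, 0)).comp (hlim.prodMk_nhds (hw.comp hφ.tendsto_atTop))
  rw [geodesicFlow_toUnitTangent, ← lowerMatrix_zero]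
  exact mem_closure_of_tendsto h (Eventually.of_forall fun n => hmem (φ n))
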